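/- Let $\mathbb K$ be a field, let $s,a,b,m$ be positive integers with $(b-1)s+1<a\le bs$, and let \[ I=I_a(z_1^b\cdots z_s^b)=\bigl\langle z_1^{n_1}\cdots z_s^{n_s} : 0\le n_i\le b \text{ for all } i,\ n_1+\cdots+n_s=a\bigr\rangle\subset T=\mathbb K[z_1,\dots,z_s]. \] Let $I^{(m)}=\bigcap_{\mathfrak p\in\operatorname{Ass}(T/I)}(I^mT_{\mathfrak p}\cap T)$ be the $m$-th symbolic power of $I$. Put \[ \delta=a-(b-1)s-1,\qquad c_0=s-\Bigl\lfloor\frac{a-1}{b}\Bigr\rfloor,\qquad \mu_a^0=a-b(s-c_0). \] Let $\Lambda(I,m)$ be the set of all sequences $\lambda=(\lambda_1\le\lambda_2\le\cdots\le\lambda_s)$ of non-negative integers such that \[ \lambda_1+\cdots+\lambda_{s-\delta}=m\bigl(\mu_a^0+b(s-\delta-c_0)\bigr)\quad\text{and}\quad \lambda_{s-\delta}=\lambda_{s-\delta+1}=\cdots=\lambda_s<mb. \] For such $\lambda$ put $\operatorname{type}(\lambda)!=\prod_{i\ge 0}t_i!$, where $t_i=|\{k:\lambda_k=i\}|$.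 Then $\Lambda(I,m)$ is finite, and the symbolic defect of $I$, i.e. the minimal number of generators $\mu(I^{(m)}/I^m)$ of the $T$-module $I^{(m)}/I^m$, is \[ \operatorname{sdefect}(I,m)=\mu(I^{(m)}/I^m)=\sum_{\lambda\in\Lambda(I,m)}\frac{s!}{\operatorname{type}(\lambda)!}. \] -/

import Mathlib

/-- The `a`-fold product ideal `I_a(f₁^{m₁} ⋯ f_s^{m_s})`: it is generated by all products
`f₁^{n₁} ⋯ f_s^{n_s}` with `0 ≤ nᵢ ≤ mᵢ` for every `i` and `n₁ + ⋯ + n_s = a`. -/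
def foldProductIdeal {R : Type*} [CommRing R] {s : ℕ} (f : Fin s → R) (mult : Fin s → ℕ)
    (a : ℕ) : Ideal R :=
  Ideal.span {g | ∃ n : Fin s → ℕ, (∀ i, n i ≤ mult i) ∧ ∑ i, n i = a ∧ g = ∏ i, f i ^ n i}

/-- The uniform monomial `a`-fold product ideal `I_a(z₁^b ⋯ z_s^b)` in `K[z₁, …, z_s]`. -/
noncomputable def uniformMonomialIdeal (K : Type*) [Field K] (s a b : ℕ) :
    Ideal (MvPolynomial (Fin s) K) :=
  foldProductIdeal (fun i => MvPolynomial.X i) (fun _ => b) a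

/-- The contraction `J R_p ∩ R` of the extension of an ideal `J` to the localization at a prime
ideal `p`. -/
noncomputable def localizedContraction {R : Type*} [CommRing R] (J p : Ideal R) [p.IsPrime] :
    Ideal R :=
  (J.map (algebraMap R (Localization.AtPrime p))).comap (algebraMap R (Localization.AtPrime p))

/-- The `m`-th symbolic power `I^(m)`, the intersection of the ideals `I^m R_p ∩ R` over all
associated primes `p` of `R ⧸ I`. -/
noncomputable def symbolicPower {R : Type*} [CommRing R] [IsDomain R] [IsNoetherianRing R]
    (I : Ideal R) (m : ℕ) : Ideal R :=
  ⨅ (p : Ideal R) (hp : p ∈ associatedPrimes R (R ⧸ I)),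
    haveI : p.IsPrime := hp.isPrime
    localizedContraction (I ^ m) p

/-- The symbolic defect `sdefect(I, m) = μ(I^(m) / I^m)`: the minimal number of generators of the
`R`-module `I^(m) / I^m`, which is finitely generated because `R` is Noetherian. -/
noncomputable def symbolicDefect {R : Type*} [CommRing R] [IsDomain R] [IsNoetherianRing R]
    (I : Ideal R) (m : ℕ) : ℕ :=
  (⊤ : Submodule R (symbolicPower I m ⧸ (I ^ m).submoduleOf (symbolicPower I m))).spanFinrank

/-- `δ = a - (b - 1) s - 1`. -/
def deltaParam (s a b : ℕ) : ℕ := a - (b - 1) * s - 1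

/-- `c₀ = s - ⌊(a - 1) / b⌋`. -/
def c0Param (s a b : ℕ) : ℕ := s - (a - 1) / b

/-- `μ_a⁰ = a - b (s - c₀)`. -/
def mu0Param (s a b : ℕ) : ℕ := a - b * (s - c0Param s a b)

/-- `|λ_{≤ k}| = λ₁ + ⋯ + λ_k`; the entry `λ_j` with `1 ≤ j ≤ s` is stored at index `j - 1`. -/
def truncatedSize {s : ℕ} (lam : Fin s → ℕ) (k : ℕ) : ℕ :=
  ∑ i ∈ Finset.univ.filter (fun j : Fin s => (j : ℕ) + 1 ≤ k), lam i

/-- `type(λ)! = t₀! t₁! ⋯ t_d!`, where `d = |λ|` and `tᵢ` is the number of entries of `λ` that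
are equal to `i`. -/
def typeFactorial {s : ℕ} (lam : Fin s → ℕ) : ℕ :=
  ∏ i ∈ Finset.range (∑ k, lam k + 1), (Finset.card {k | lam k = i}).factorial

/-- `Λ(I, m)` for `I = I_a(z₁^b ⋯ z_s^b)`: the set of partitions `λ₁ ≤ ⋯ ≤ λ_s` of length `s`
(zero entries allowed) with `|λ_{≤ s-δ}| = m (μ_a⁰ + b (s - δ - c₀))` and
`λ_{s-δ} = ⋯ = λ_s < m b`. -/
def defectPartitions (s a b m : ℕ) : Set (Fin s → ℕ) :=
  {lam | Monotone lam ∧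
    truncatedSize lam (s - deltaParam s a b) =
      m * (mu0Param s a b + b * (s - deltaParam s a b - c0Param s a b)) ∧
    (∀ i j : Fin s, s - deltaParam s a b ≤ (i : ℕ) + 1 → s - deltaParam s a b ≤ (j : ℕ) + 1 →
      lam i = lam j) ∧
    ∀ i : Fin s, s - deltaParam s a b ≤ (i : ℕ) + 1 → lam i < m * b}

/-- In the range `(b - 1) s + 1 < a ≤ b s` no subtraction in the definitions above is truncated. -/
theorem param_identities (s a b : ℕ) (hb : 1 ≤ b) (ha : (b - 1) * s + 1 < a) (ha' : a ≤ b * s) :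
    (b - 1) * s + 1 + deltaParam s a b = a ∧ c0Param s a b + (a - 1) / b = s ∧
      mu0Param s a b + b * (s - c0Param s a b) = a ∧
      1 ≤ c0Param s a b ∧ c0Param s a b + deltaParam s a b ≤ s := by
  obtain ⟨d, rfl⟩ : ∃ d, b = d + 1 := ⟨b - 1, by omega⟩
  simp only [Nat.add_sub_cancel] at *
  have e1 : (d + 1) * s = d * s + s := by ring
  have h1 : (a - 1) / (d + 1) < s := by
    rw [Nat.div_lt_iff_lt_mul (by omega), mul_comm]; omega
  have h2 : (d + 1) * ((a - 1) / (d + 1)) ≤ a - 1 := Nat.mul_div_le _ _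
  have h3 : a - d * s - 1 ≤ (a - 1) / (d + 1) := by
    rw [Nat.le_div_iff_mul_le (by omega)]
    obtain ⟨k, hk⟩ : ∃ k, a = d * s + 1 + k := ⟨a - d * s - 1, by omega⟩
    have hks : k ≤ s := by omega
    have : a - d * s - 1 = k := by omega
    rw [this]
    have : k * (d + 1) = d * k + k := by ring
    have := Nat.mul_le_mul_left d hks
    omega
  have h4 : s - (s - (a - 1) / (d + 1)) = (a - 1) / (d + 1) := by omega
  simp only [deltaParam, c0Param, mu0Param, Nat.add_sub_cancel, h4]
  omega

/-! Put k = s - δ, so a + k = bs + 1, and C = ma - mb(s - k), which is the size prescribed for λ_1 +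
... + λ_k. All ideals involved are monomial, so everything reduces to exponents. The power I^m
consists of the x with ∑ min(x_i, mb) ≥ ma (`nsmul_powerExponents`). Every set of k variables
generates an associated prime, and no associated prime contains more than k variables; hence I^(m)
consists of the x with ∑_{i ∈ S} min(x_i, mb) ≥ C for all S of size k
(`symbolicPower_uniformMonomialIdeal`).

By a graded Nakayama argument, μ(I^(m)/I^m) counts the minimal exponents of I^(m) outside I^m
(`spanFinrank_restrictSupportIdeal_quotient`). This set is stable under permutations. A sorted tuple
lies in it exactly when its first k entries sum to C and the entries from the k-th on share a value
t < mb (`mem_minimalTuples_iff_of_monotone`): the total is then C + t(s - k), below ma = C + mb(s -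
k). The orbit of λ has s!/type(λ)! elements. -/

/-! ### Monomial ideals as sets of exponents. -/

section MonomialIdeals

open MvPolynomial Finset

variable {σ K : Type*} [Field K]

/-- Membership in a monomial ideal is a condition on the support. -/
theorem mem_restrictSupportIdeal_iff {W : Set (σ →₀ ℕ)} {hW : IsUpperSet W}
    {f : MvPolynomial σ K} :
    f ∈ restrictSupportIdeal (R := K) W hW ↔ ∀ x ∈ f.support, x ∈ W :=
  Iff.rfl

theorem monomial_mem_restrictSupportIdeal_iff {W : Set (σ →₀ ℕ)} {hW : IsUpperSet W}
    {x : σ →₀ ℕ} : monomial x (1 : K) ∈ restrictSupportIdeal (R := K) W hW ↔ x ∈ W := by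
  classical
  rw [mem_restrictSupportIdeal_iff, support_monomial]
  simp

theorem restrictSupportIdeal_mono {V W : Set (σ →₀ ℕ)} {hV : IsUpperSet V} {hW : IsUpperSet W}
    (h : V ⊆ W) : restrictSupportIdeal (R := K) V hV ≤ restrictSupportIdeal (R := K) W hW :=
  fun _ hf _ hx => h (hf hx)

-- Turns powers of monomial ideals into Minkowski multiples of exponent sets.
open scoped Pointwise in
theorem restrictSupportIdeal_pow {V W : Set (σ →₀ ℕ)} {hV : IsUpperSet V} {hW : IsUpperSet W}
    {n : ℕ} (hn : n ≠ 0) (h : n • V = W) :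
    restrictSupportIdeal (R := K) V hV ^ n = restrictSupportIdeal (R := K) W hW := by
  apply Submodule.restrictScalars_injective K
  rw [Submodule.restrictScalars_pow hn]
  simp [← restrictSupport_nsmul, h]

/-- Restriction of a polynomial to the exponents in a set. -/
theorem exists_support_split (f : MvPolynomial σ K) (P : (σ →₀ ℕ) → Prop) :
    ∃ f₁ f₂ : MvPolynomial σ K, f = f₁ + f₂ ∧ (∀ x ∈ f₁.support, x ∈ f.support ∧ P x) ∧
      (∀ x ∈ f₂.support, x ∈ f.support ∧ ¬ P x) ∧ ∀ x, P x → coeff x f₁ = coeff x f := by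
  classical
  have hc : ∀ (Q : (σ →₀ ℕ) → Prop) [DecidablePred Q] (x : σ →₀ ℕ),
      coeff x (∑ y ∈ f.support.filter Q, monomial y (coeff y f)) =
        if Q x then coeff x f else 0 := by
    intro Q _ x
    rw [coeff_sum]
    simp only [coeff_monomial, Finset.sum_ite_eq', mem_filter, mem_support_iff]
    split_ifs <;> grind
  refine ⟨∑ y ∈ f.support.filter P, monomial y (coeff y f),
    ∑ y ∈ f.support.filter (fun x => ¬ P x), monomial y (coeff y f), ?_, ?_, ?_, ?_⟩
  · ext x
    rw [coeff_add, hc, hc]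
    split_ifs <;> simp_all
  · intro x hx
    rw [mem_support_iff, hc] at hx
    rw [mem_support_iff]
    split_ifs at hx <;> simp_all
  · intro x hx
    rw [mem_support_iff, hc] at hx
    rw [mem_support_iff]
    split_ifs at hx <;> simp_all
  · intro x hx
    rw [hc, if_pos hx]

theorem exists_add_of_mem_support_mul {f g : MvPolynomial σ K} {z : σ →₀ ℕ}
    (hz : z ∈ (f * g).support) : ∃ x ∈ f.support, ∃ y ∈ g.support, x + y = z := by
  classical
  simpa [Finset.mem_add] using support_mul f g hz

theorem mul_monomial_mem_restrictSupportIdeal_iff {W : Set (σ →₀ ℕ)} {hW : IsUpperSet W}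
    {f : MvPolynomial σ K} {y : σ →₀ ℕ} :
    f * monomial y 1 ∈ restrictSupportIdeal (R := K) W hW ↔ ∀ x ∈ f.support, x + y ∈ W := by
  classical
  constructor
  · intro h x hx
    refine h (show x + y ∈ (f * monomial y (1 : K)).support from ?_)
    rw [mem_support_iff, coeff_mul_monomial, mul_one]
    exact mem_support_iff.1 hx
  · intro h z hz
    obtain ⟨x, hx, y', hy', rfl⟩ := exists_add_of_mem_support_mul hz
    rw [support_monomial, if_neg one_ne_zero, Finset.mem_singleton] at hy'
    exact hy' ▸ h x hx

/-- A polynomial having a term without variables from `S` is a nonzerodivisor modulo any monomial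
ideal defined by a condition on the exponents of the variables in `S`. -/
theorem mem_restrictSupportIdeal_of_mul_mem {W : Set (σ →₀ ℕ)} {hW : IsUpperSet W} (S : Finset σ)
    (hS : ∀ x y : σ →₀ ℕ, (∀ i ∈ S, x i = y i) → x ∈ W → y ∈ W) {f g : MvPolynomial σ K}
    (hg : ∃ y ∈ g.support, ∀ i ∈ S, y i = 0)
    (h : g * f ∈ restrictSupportIdeal (R := K) W hW) :
    f ∈ restrictSupportIdeal (R := K) W hW := by
  classical
  rw [mem_restrictSupportIdeal_iff]
  by_contra! hf
  -- Lowest-degree argument: `d` is the degree in the variables of `S`, `f₁` collects the terms of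
  -- `f` outside `W` of least `d`, and `g₁` the terms of `g` with `d = 0`. A term `z` of `g₁ * f₁`
  -- cannot cancel, since every other product lies in `W` or has larger `d`.
  let d : (σ →₀ ℕ) → ℕ := fun x => ∑ i ∈ S, x i
  have hd : ∀ x y, d (x + y) = d x + d y := fun x y => by simp [d, sum_add_distrib]
  obtain ⟨x₀, hx₀, hmin⟩ := (f.support.filter (· ∉ W)).exists_min_image d
    (by obtain ⟨x, hx⟩ := hf; exact ⟨x, by simpa using hx⟩)
  rw [mem_filter] at hx₀
  obtain ⟨y₀, hy₀, hy₀'⟩ := hg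
  obtain ⟨f₁, f₂, hf12, hf₁, hf₂, hf₁c⟩ := exists_support_split f (fun x => x ∉ W ∧ d x = d x₀)
  obtain ⟨g₁, g₂, hg12, hg₁, hg₂, hg₁c⟩ := exists_support_split g (fun x => d x = 0)
  have hf₁0 : f₁ ≠ 0 := by
    intro h0
    have := hf₁c x₀ ⟨hx₀.2, rfl⟩
    rw [h0, coeff_zero] at this
    exact (mem_support_iff.mp hx₀.1) this.symm
  have hg₁0 : g₁ ≠ 0 := by
    intro h0
    have := hg₁c y₀ (sum_eq_zero hy₀')
    rw [h0, coeff_zero] at this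
    exact (mem_support_iff.mp hy₀) this.symm
  obtain ⟨z, hz⟩ := (support_nonempty (p := g₁ * f₁)).2 (mul_ne_zero hg₁0 hf₁0)
  have hmemW : ∀ x y, d x = 0 → (x + y ∈ W ↔ y ∈ W) := by
    intro x y hx
    have hx' : ∀ i ∈ S, x i = 0 := by simpa [d] using hx
    exact ⟨hS _ _ fun i hi => by simp [hx' i hi], fun hy => hW (by simp) hy⟩
  have hz' : z ∉ W ∧ d z = d x₀ := by
    obtain ⟨x, hx, y, hy, rfl⟩ := exists_add_of_mem_support_mul hz
    rw [hd, (hg₁ x hx).2, hmemW x y (hg₁ x hx).2, zero_add]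
    exact (hf₁ y hy).2
  have key : ∀ p q : MvPolynomial σ K, (∀ x ∈ p.support, ∀ y ∈ q.support,
      x + y ∈ W ∨ d x₀ < d (x + y)) → coeff z (p * q) = 0 := by
    intro p q hpq
    by_contra hne
    obtain ⟨x, hx, y, hy, rfl⟩ := exists_add_of_mem_support_mul (mem_support_iff.2 hne)
    rcases hpq x hx y hy with h | h
    · exact hz'.1 h
    · exact absurd hz'.2 h.ne'
  have hfd : ∀ y ∈ f.support, y ∈ W ∨ d x₀ ≤ d y := by
    intro y hy
    by_cases hyW : y ∈ W
    · exact Or.inl hyW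
    · exact Or.inr (hmin y (by simp [hyW, mem_support_iff.1 hy]))
  have e : g * f = g₁ * f₁ + (g₁ * f₂ + g₂ * f) := by
    rw [hg12]; conv_lhs => rw [hf12]
    conv_rhs => rw [hf12]
    ring
  have h1 : coeff z (g₁ * f₂) = 0 := by
    refine key _ _ fun x hx y hy => ?_
    have h2 := hf₂ y hy
    rw [hmemW x y (hg₁ x hx).2, hd, (hg₁ x hx).2, zero_add]
    rcases hfd y h2.1 with h | h
    · exact Or.inl h
    · by_cases hyW : y ∈ W
      · exact Or.inl hyW
      · exact Or.inr (lt_of_le_of_ne h fun he => h2.2 ⟨hyW, he.symm⟩)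
  have h2 : coeff z (g₂ * f) = 0 := by
    refine key _ _ fun x hx y hy => ?_
    rcases hfd y hy with h | h
    · exact Or.inl (hW (by simp) h)
    · refine Or.inr ?_
      rw [hd]
      have := (hg₂ x hx).2
      omega
  refine hz'.1 (h (show z ∈ (g * f).support from ?_))
  rw [mem_support_iff, e, coeff_add, coeff_add, h1, h2, add_zero, add_zero]
  exact mem_support_iff.1 hz

theorem isUpperSet_exists_pos (S : Finset σ) :
    IsUpperSet {x : σ →₀ ℕ | ∃ i ∈ S, 0 < x i} :=
  fun _ _ h ⟨i, hi, hx⟩ => ⟨i, hi, hx.trans_le (h i)⟩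

/-- This is the ideal generated by the variables in `S`; a polynomial outside it has a term free of
`S`, hence is a nonzerodivisor modulo it. -/
theorem isPrime_restrictSupportIdeal_exists_pos (S : Finset σ) :
    (restrictSupportIdeal (R := K) _ (isUpperSet_exists_pos S)).IsPrime := by
  refine ⟨?_, ?_⟩
  · rw [Ideal.ne_top_iff_one]
    intro h
    have h0 : monomial (0 : σ →₀ ℕ) (1 : K) ∈
      restrictSupportIdeal (R := K) _ (isUpperSet_exists_pos S) := h
    rw [monomial_mem_restrictSupportIdeal_iff] at h0
    obtain ⟨i, _, hi⟩ := h0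
    simp at hi
  · intro f g hfg
    by_contra! hcon
    refine hcon.2 (mem_restrictSupportIdeal_of_mul_mem S ?_ ?_ hfg)
    · rintro x y hxy ⟨i, hi, hx⟩
      exact ⟨i, hi, hxy i hi ▸ hx⟩
    · have := hcon.1
      rw [mem_restrictSupportIdeal_iff] at this
      push Not at this
      obtain ⟨y, hy, hy'⟩ := this
      exact ⟨y, hy, by simpa using hy'⟩

end MonomialIdeals

/-! ### Symbolic powers and associated primes, elementwise. -/

section SymbolicPowers

/-- The contraction of an extended ideal consists of the elements that are multiplied into it by an
element outside of the prime. -/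
theorem mem_localizedContraction_iff {R : Type*} [CommRing R] (J p : Ideal R) [p.IsPrime] {f : R} :
    f ∈ localizedContraction J p ↔ ∃ g, g ∉ p ∧ g * f ∈ J := by
  rw [localizedContraction, Ideal.mem_comap,
    IsLocalization.algebraMap_mem_map_algebraMap_iff p.primeCompl]
  rfl

theorem mem_symbolicPower_iff {R : Type*} [CommRing R] [IsDomain R] [IsNoetherianRing R]
    (I : Ideal R) (m : ℕ) {f : R} :
    f ∈ symbolicPower I m ↔
      ∀ p ∈ associatedPrimes R (R ⧸ I), ∃ g, g ∉ p ∧ g * f ∈ I ^ m := by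
  simp only [symbolicPower, Submodule.mem_iInf]
  refine forall₂_congr fun p hp => ?_
  have : p.IsPrime := hp.isPrime
  exact mem_localizedContraction_iff _ _

theorem mem_associatedPrimes_quotient_iff {R : Type*} [CommRing R] [IsNoetherianRing R]
    {I p : Ideal R} :
    p ∈ associatedPrimes R (R ⧸ I) ↔ p.IsPrime ∧ ∃ h : R, ∀ r, r ∈ p ↔ r * h ∈ I := by
  rw [AssociatedPrimes.mem_iff, isAssociatedPrime_iff]
  refine and_congr_right fun _ => ?_
  have aux : ∀ h r : R, r ∈ (⊥ : Submodule R (R ⧸ I)).colon {Ideal.Quotient.mk I h} ↔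
      r * h ∈ I := by
    intro h r
    rw [Submodule.mem_colon_singleton, Submodule.mem_bot, ← Ideal.Quotient.eq_zero_iff_mem, map_mul]
    rfl
  constructor
  · rintro ⟨x, rfl⟩
    obtain ⟨h, rfl⟩ := Ideal.Quotient.mk_surjective x
    exact ⟨h, aux h⟩
  · rintro ⟨h, hh⟩
    exact ⟨Ideal.Quotient.mk I h, Ideal.ext fun r => (hh r).trans (aux h r).symm⟩

end SymbolicPowers

/-! ### Exponent sets of ordinary and symbolic powers. -/

section Exponents

open Finset

variable {σ : Type*} [Fintype σ]

/-- Integer points between two tuples realize every intermediate sum. -/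
theorem exists_between_sum_eq {l u : σ → ℕ} (hlu : ∀ i, l i ≤ u i) {n : ℕ}
    (hl : ∑ i, l i ≤ n) (hu : n ≤ ∑ i, u i) :
    ∃ g : σ → ℕ, (∀ i, l i ≤ g i) ∧ (∀ i, g i ≤ u i) ∧ ∑ i, g i = n := by
  classical
  induction n, hl using Nat.le_induction with
  | base => exact ⟨l, fun _ => le_rfl, hlu, rfl⟩
  | succ n _ ih =>
    obtain ⟨g, hg₁, hg₂, hg₃⟩ := ih (by omega)
    obtain ⟨i, hi⟩ : ∃ i, g i < u i := by
      by_contra! h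
      have := sum_le_sum fun i (_ : i ∈ univ) => h i
      omega
    refine ⟨fun j => g j + if j = i then 1 else 0, fun j => (hg₁ j).trans (Nat.le_add_right _ _),
      fun j => ?_, ?_⟩
    · have := hg₂ j
      dsimp only
      split_ifs with h
      · subst h; omega
      · omega
    · simp [sum_add_distrib, hg₃]

/-- The exponents of the monomials in a power of a uniform monomial fold product ideal. -/
def powerExponents (σ : Type*) [Fintype σ] (c n : ℕ) : Set (σ →₀ ℕ) :=
  {x | n ≤ ∑ i, min (x i) c}

/-- The exponents of the monomials in a symbolic power of a uniform monomial fold product ideal. -/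
def symbolicExponents (σ : Type*) (k c n : ℕ) : Set (σ →₀ ℕ) :=
  {x | ∀ S : Finset σ, #S = k → n ≤ ∑ i ∈ S, min (x i) c}

theorem isUpperSet_powerExponents (c n : ℕ) : IsUpperSet (powerExponents σ c n) :=
  fun _ _ h hx => le_trans hx (sum_le_sum fun i _ => min_le_min_right _ (h i))

theorem isUpperSet_sum_min (σ : Type*) (S : Finset σ) (c n : ℕ) :
    IsUpperSet {x : σ →₀ ℕ | n ≤ ∑ i ∈ S, min (x i) c} :=
  fun _ _ h hx => le_trans hx (sum_le_sum fun i _ => min_le_min_right _ (h i))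

theorem isUpperSet_symbolicExponents (σ : Type*) (k c n : ℕ) :
    IsUpperSet (symbolicExponents σ k c n) :=
  fun _ _ h hx S hS => isUpperSet_sum_min σ S c n h (hx S hS)

theorem exists_le_of_mem_powerExponents {c n : ℕ} {x : σ →₀ ℕ} (hx : x ∈ powerExponents σ c n) :
    ∃ y : σ →₀ ℕ, (∀ i, y i ≤ c) ∧ ∑ i, y i = n ∧ y ≤ x := by
  obtain ⟨g, _, hg₂, hg₃⟩ := exists_between_sum_eq (l := fun _ => 0)
    (u := fun i => min (x i) c) (fun _ => Nat.zero_le _) (n := n) (by simp) hx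
  refine ⟨Finsupp.equivFunOnFinite.symm g, fun i => ?_, by simpa using hg₃, fun i => ?_⟩
  · exact (hg₂ i).trans (min_le_right _ _)
  · exact (hg₂ i).trans (min_le_left _ _)

open scoped Pointwise in
theorem powerExponents_add (b a m : ℕ) :
    powerExponents σ (m * b) (m * a) + powerExponents σ b a =
      powerExponents σ ((m + 1) * b) ((m + 1) * a) := by
  apply Set.Subset.antisymm
  · rintro _ ⟨x, hx, y, hy, rfl⟩
    simp only [powerExponents, Set.mem_ofPred_eq, Finsupp.add_apply, add_mul, one_mul] at *
    refine (add_le_add hx hy).trans ?_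
    rw [← sum_add_distrib]
    exact sum_le_sum fun i _ => by omega
  · intro x hx
    obtain ⟨x', hx'₁, hx'₂, hx'₃⟩ := exists_le_of_mem_powerExponents hx
    -- The average `x' / (m + 1)` sums to `a` and lies between the two bounds, so some integer point
    -- does as well.
    obtain ⟨g, hg₁, hg₂, hg₃⟩ := exists_between_sum_eq (l := fun i => x' i - m * b)
      (u := fun i => min (x' i) b) (n := a)
      (fun i => by have := hx'₁ i; rw [add_mul, one_mul] at this; omega)
      (by
        refine Nat.le_of_mul_le_mul_left ?_ (Nat.succ_pos m)
        rw [← Nat.add_one, ← hx'₂, mul_sum]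
        refine sum_le_sum fun i _ => ?_
        rw [Nat.mul_sub, tsub_le_iff_right, add_mul, one_mul, add_comm]
        refine Nat.add_le_add_left ?_ _
        refine (Nat.mul_le_mul_left m (hx'₁ i)).trans_eq ?_
        ring)
      (by
        refine Nat.le_of_mul_le_mul_left ?_ (Nat.succ_pos m)
        rw [← Nat.add_one, ← hx'₂, mul_sum]
        refine sum_le_sum fun i _ => ?_
        rw [← Nat.mul_min_mul_left]
        refine le_min (Nat.le_mul_of_pos_left _ (Nat.succ_pos m)) (hx'₁ i))
    refine ⟨x - Finsupp.equivFunOnFinite.symm g, ?_, Finsupp.equivFunOnFinite.symm g, ?_, ?_⟩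
    · have h1 : ∑ i, (x' i - g i) = m * a := by
        have : ∑ i, (x' i - g i) + ∑ i, g i = ∑ i, x' i := by
          rw [← sum_add_distrib]
          exact sum_congr rfl fun i _ => by have := hg₂ i; omega
        rw [hg₃, hx'₂, add_mul, one_mul] at this
        omega
      simp only [powerExponents, Set.mem_ofPred_eq]
      rw [← h1]
      refine sum_le_sum fun i _ => ?_
      have h2 := hx'₃ i
      have h3 := hg₁ i
      simp only [Finsupp.tsub_apply, Finsupp.equivFunOnFinite_symm_apply_apply]
      omega
    · simp only [powerExponents, Set.mem_ofPred_eq]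
      rw [← hg₃]
      refine sum_le_sum fun i _ => ?_
      have h3 := hg₂ i
      simp only [Finsupp.equivFunOnFinite_symm_apply_apply]
      omega
    · ext i
      have h2 := hx'₃ i
      have h3 := hg₂ i
      simp only [Finsupp.tsub_apply, Finsupp.add_apply, Finsupp.equivFunOnFinite_symm_apply_apply]
      omega

open scoped Pointwise in
theorem nsmul_powerExponents (b a : ℕ) {m : ℕ} (hm : 1 ≤ m) :
    m • powerExponents σ b a = powerExponents σ (m * b) (m * a) := by
  induction m, hm using Nat.le_induction with
  | base => simp
  | succ m _ ih => rw [succ_nsmul, ih, powerExponents_add]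

/-- The entries outside `S` contribute at most `c` each. -/
theorem powerExponents_subset_sum_min {k c n C : ℕ} (h : C + c * (Fintype.card σ - k) = n)
    {S : Finset σ} (hS : #S = k) :
    powerExponents σ c n ⊆ {x | C ≤ ∑ i ∈ S, min (x i) c} := by
  classical
  intro x hx
  simp only [powerExponents, Set.mem_ofPred_eq] at hx ⊢
  rw [← sum_add_sum_compl S] at hx
  have h1 : ∑ i ∈ Sᶜ, min (x i) c ≤ #Sᶜ • c := sum_le_card_nsmul _ _ _ fun i _ => min_le_right _ _
  rw [card_compl, hS, smul_eq_mul, mul_comm] at h1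
  omega

/-- Enlarge `S` to size `k`; each new entry adds at most `c`. Sets smaller than `k` matter because
an associated prime is only known to contain at most `k` variables. -/
theorem sum_min_of_mem_symbolicExponents {k c n C : ℕ} (hk : k ≤ Fintype.card σ)
    (h : C + c * (Fintype.card σ - k) = n) {x : σ →₀ ℕ} (hx : x ∈ symbolicExponents σ k c C)
    {S : Finset σ} (hS : #S ≤ k) : n ≤ ∑ i ∈ S, min (x i) c + c * (Fintype.card σ - #S) := by
  classical
  obtain ⟨S', hSS', hS'⟩ := exists_superset_card_eq hS hk
  have h1 := hx S' hS'
  rw [← sum_sdiff hSS'] at h1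
  have h2 : ∑ i ∈ S' \ S, min (x i) c ≤ #(S' \ S) • c :=
    sum_le_card_nsmul _ _ _ fun i _ => min_le_right _ _
  rw [card_sdiff_of_subset hSS', hS', smul_eq_mul, mul_comm] at h2
  have h3 : c * (Fintype.card σ - #S) = c * (Fintype.card σ - k) + c * (k - #S) := by
    rw [← mul_add]; congr 1; omega
  omega

end Exponents

/-! ### Powers, associated primes and symbolic powers of fold product ideals. -/

section FoldProductIdeals

open MvPolynomial Finset

variable {K : Type*} [Field K] {s a b k m : ℕ}

theorem uniformMonomialIdeal_eq (K : Type*) [Field K] (s a b : ℕ) :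
    uniformMonomialIdeal K s a b =
      restrictSupportIdeal (R := K) _ (isUpperSet_powerExponents (σ := Fin s) b a) := by
  have hset : {g : MvPolynomial (Fin s) K | ∃ n : Fin s → ℕ, (∀ i, n i ≤ b) ∧ ∑ i, n i = a ∧
      g = ∏ i, X i ^ n i} = (fun y => monomial y (1 : K)) ''
        {y : Fin s →₀ ℕ | (∀ i, y i ≤ b) ∧ ∑ i, y i = a} := by
    have hprod : ∀ y : Fin s →₀ ℕ, (∏ i, X i ^ y i : MvPolynomial (Fin s) K) = monomial y 1 := by
      intro y
      rw [monomial_eq, C_1, one_mul, Finsupp.prod_fintype _ _ fun _ => pow_zero _]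
    ext g
    constructor
    · rintro ⟨n, hn₁, hn₂, rfl⟩
      exact ⟨Finsupp.equivFunOnFinite.symm n, ⟨hn₁, hn₂⟩,
        (hprod (Finsupp.equivFunOnFinite.symm n)).symm⟩
    · rintro ⟨y, ⟨hy₁, hy₂⟩, rfl⟩
      exact ⟨y, hy₁, hy₂, (hprod y).symm⟩
  ext f
  rw [uniformMonomialIdeal, foldProductIdeal, hset, mem_ideal_span_monomial_image,
    mem_restrictSupportIdeal_iff]
  refine forall₂_congr fun x _ => ⟨?_, ?_⟩
  · rintro ⟨y, ⟨hy₁, hy₂⟩, hyx⟩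
    refine isUpperSet_powerExponents b a hyx ?_
    simp [powerExponents, hy₁, hy₂]
  · intro hx
    obtain ⟨y, hy₁, hy₂, hy₃⟩ := exists_le_of_mem_powerExponents hx
    exact ⟨y, ⟨hy₁, hy₂⟩, hy₃⟩

theorem uniformMonomialIdeal_pow (K : Type*) [Field K] (s a b : ℕ) (hm : 1 ≤ m) :
    uniformMonomialIdeal K s a b ^ m = restrictSupportIdeal (R := K) _
      (isUpperSet_powerExponents (σ := Fin s) (m * b) (m * a)) := by
  rw [uniformMonomialIdeal_eq]
  exact restrictSupportIdeal_pow (by omega) (nsmul_powerExponents b a hm)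

theorem restrictSupportIdeal_exists_pos_mem_associatedPrimes (hb : 1 ≤ b) (hak : a + k = b * s + 1)
    {S : Finset (Fin s)} (hS : #S = k) :
    restrictSupportIdeal (R := K) _ (isUpperSet_exists_pos S) ∈
      associatedPrimes (MvPolynomial (Fin s) K)
        (MvPolynomial (Fin s) K ⧸ uniformMonomialIdeal K s a b) := by
  classical
  rw [mem_associatedPrimes_quotient_iff]
  refine ⟨isPrime_restrictSupportIdeal_exists_pos S, ?_⟩
  -- This exponent has total `a - 1` and room below `b` exactly at the indices in `S`, so a monomial
  -- multiplies it into the ideal iff it involves a variable of `S`.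
  let y : Fin s →₀ ℕ := Finsupp.equivFunOnFinite.symm fun i => b - if i ∈ S then 1 else 0
  have hy : ∀ i, y i + (if i ∈ S then 1 else 0) = b := by
    intro i
    simp only [y, Finsupp.equivFunOnFinite_symm_apply_apply]
    split_ifs <;> omega
  have hysum : ∑ i, y i + k = b * s := by
    have := sum_congr rfl fun i (_ : i ∈ univ) => hy i
    rw [sum_add_distrib] at this
    simpa [hS, mul_comm] using this
  refine ⟨monomial y 1, fun r => ?_⟩
  rw [uniformMonomialIdeal_eq, mul_monomial_mem_restrictSupportIdeal_iff,
    mem_restrictSupportIdeal_iff]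
  refine forall₂_congr fun x _ => ?_
  simp only [powerExponents, Set.mem_ofPred_eq, Finsupp.add_apply]
  constructor
  · rintro ⟨i, hi, hxi⟩
    have : ∑ i, y i < ∑ i, min (x i + y i) b := by
      refine sum_lt_sum (fun j _ => ?_) ⟨i, mem_univ i, ?_⟩
      · have := hy j; omega
      · have := hy i; rw [if_pos hi] at this; omega
    omega
  · intro h
    by_contra! hx
    have : ∑ i, min (x i + y i) b ≤ ∑ i, y i := by
      refine sum_le_sum fun j _ => ?_
      have := hy j
      by_cases hj : j ∈ S
      · have := hx j hj; omega
      · rw [if_neg hj] at this; omega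
    omega

/-- Write p = (I : h) and take an exponent `x` of `h` outside I. Each variable in `S` moves `x` into
I, so `x i < b` on `S` and, if `S` is nonempty, a - 1 ≤ ∑ min(x_i, b) ≤ bs - #S. -/
theorem card_variables_le_of_mem_associatedPrimes (hak : a + k = b * s + 1)
    {p : Ideal (MvPolynomial (Fin s) K)} (hp : p ∈ associatedPrimes (MvPolynomial (Fin s) K)
        (MvPolynomial (Fin s) K ⧸ uniformMonomialIdeal K s a b))
    {S : Finset (Fin s)} (hS : ∀ i ∈ S, X i ∈ p) : #S ≤ k := by
  classical
  obtain ⟨hprime, h, hh⟩ := mem_associatedPrimes_quotient_iff.1 hp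
  rw [uniformMonomialIdeal_eq] at hh
  have h1 : h ∉ restrictSupportIdeal (R := K) _
      (isUpperSet_powerExponents (σ := Fin s) b a) := by
    intro hmem
    refine hprime.ne_top ((Ideal.eq_top_iff_one p).2 ((hh 1).2 ?_))
    rwa [one_mul]
  rw [mem_restrictSupportIdeal_iff] at h1
  push Not at h1
  obtain ⟨x, hx, hxU⟩ := h1
  have h2 : ∀ i ∈ S, x + Finsupp.single i 1 ∈ powerExponents (Fin s) b a := by
    intro i hi
    have := (hh _).1 (hS i hi)
    rw [mul_comm, X, mul_monomial_mem_restrictSupportIdeal_iff] at this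
    exact this x hx
  simp only [powerExponents, Set.mem_ofPred_eq, not_le] at hxU h2
  have h3 : ∀ i, min (x i) b + (if i ∈ S then 1 else 0) ≤ b := by
    intro i
    split_ifs with hi
    · by_contra hcon
      have hle : ∑ j, min ((x + Finsupp.single i 1 : Fin s →₀ ℕ) j) b ≤ ∑ j, min (x j) b := by
        refine sum_le_sum fun j _ => ?_
        by_cases hj : i = j
        · subst hj; simp only [Finsupp.add_apply, Finsupp.single_eq_same]; omega
        · simp [hj]
      have := h2 i hi
      omega
    · simp
  have h4 : ∀ i ∈ S, a ≤ ∑ j, min (x j) b + 1 := by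
    intro i hi
    refine (h2 i hi).trans ?_
    have : (1 : ℕ) = ∑ j, if i = j then 1 else 0 := by simp
    conv_rhs => rw [this]
    rw [← sum_add_distrib]
    refine sum_le_sum fun j _ => ?_
    simp only [Finsupp.add_apply, Finsupp.single_apply]
    split_ifs <;> omega
  rcases S.eq_empty_or_nonempty with rfl | ⟨i, hi⟩
  · simp
  · have h5 := sum_le_sum fun i (_ : i ∈ univ) => h3 i
    rw [sum_add_distrib] at h5
    simp only [sum_ite_mem, univ_inter, sum_const, smul_eq_mul, mul_one, card_univ,
      Fintype.card_fin] at h5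
    have := h4 i hi
    rw [mul_comm] at hak
    omega

/-- For necessity, localize at the prime of each `k`-set. For sufficiency, multiply by the `m *
b`-th powers of all variables outside the associated prime, which saturates their truncated
exponents. -/
theorem symbolicPower_uniformMonomialIdeal (K : Type*) [Field K] {s a b k m C : ℕ} (hb : 1 ≤ b)
    (hm : 1 ≤ m) (hks : k ≤ s) (hak : a + k = b * s + 1) (hC : C + m * b * (s - k) = m * a) :
    symbolicPower (uniformMonomialIdeal K s a b) m = restrictSupportIdeal (R := K) _
      (isUpperSet_symbolicExponents (Fin s) k (m * b) C) := by
  classical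
  have hC' : C + m * b * (Fintype.card (Fin s) - k) = m * a := by simpa using hC
  ext f
  rw [mem_symbolicPower_iff]
  constructor
  · intro hf x hx S hS
    obtain ⟨g, hg, hgf⟩ := hf _ (restrictSupportIdeal_exists_pos_mem_associatedPrimes hb hak hS)
    rw [uniformMonomialIdeal_pow K s a b hm] at hgf
    rw [mem_restrictSupportIdeal_iff] at hg
    push Not at hg
    obtain ⟨y, hy, hyS⟩ := hg
    refine mem_restrictSupportIdeal_of_mul_mem (hW := isUpperSet_sum_min (Fin s) S (m * b) C) S
      ?_ ⟨y, hy, by simpa using hyS⟩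
      (restrictSupportIdeal_mono (powerExponents_subset_sum_min hC' hS) hgf) hx
    intro x y hxy h
    simp only [Set.mem_ofPred_eq] at h ⊢
    refine h.trans_eq (sum_congr rfl fun i hi => by rw [hxy i hi])
  · intro hf p hp
    let S : Finset (Fin s) := univ.filter fun i => (X i : MvPolynomial (Fin s) K) ∈ p
    have hS : #S ≤ k :=
      card_variables_le_of_mem_associatedPrimes hak hp fun i hi => (mem_filter.1 hi).2
    have := hp.isPrime
    let y : Fin s →₀ ℕ := Finsupp.equivFunOnFinite.symm fun i => if i ∈ S then 0 else m * b
    have hy : (monomial y (1 : K)) = ∏ i, X i ^ y i := by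
      rw [monomial_eq, C_1, one_mul, Finsupp.prod_fintype _ _ fun _ => pow_zero _]
    refine ⟨monomial y 1, ?_, ?_⟩
    · rw [hy, Ideal.IsPrime.prod_mem_iff]
      rintro ⟨i, _, hi⟩
      by_cases hiS : i ∈ S
      · rw [show y i = 0 by simp [y, hiS], pow_zero] at hi
        exact this.ne_top ((Ideal.eq_top_iff_one p).2 hi)
      · exact hiS (mem_filter.2 ⟨mem_univ _, this.mem_of_pow_mem _ hi⟩)
    · rw [uniformMonomialIdeal_pow K s a b hm, mul_comm (monomial y (1 : K)) f,
        mul_monomial_mem_restrictSupportIdeal_iff]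
      intro x hx
      have hx' : x ∈ symbolicExponents (Fin s) k (m * b) C := hf hx
      have h1 := sum_min_of_mem_symbolicExponents (by simpa using hks) hC' hx' hS
      refine h1.trans ?_
      rw [← sum_add_sum_compl S]
      refine add_le_add (sum_le_sum fun i _ => ?_) ?_
      · simp only [Finsupp.add_apply]; omega
      · rw [← card_compl, mul_comm, ← smul_eq_mul]
        refine card_nsmul_le_sum _ _ _ fun i hi => ?_
        have : y i = m * b := by simp [y, mem_compl.1 hi]
        rw [Finsupp.add_apply, this]
        omega

end FoldProductIdeals

/-! ### Minimal generators of quotients of monomial ideals. -/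

section MinimalGenerators

open MvPolynomial Finset

variable {σ K : Type*} [Field K] {V W : Set (σ →₀ ℕ)} {hV : IsUpperSet V}
  {hW : IsUpperSet W}

/-- A minimal `x` splits as `p + q` with `q ∈ W` only for `p = 0`. -/
theorem coeff_mul_of_minimal {x : σ →₀ ℕ} (hx : Minimal (· ∈ W) x) {f : MvPolynomial σ K}
    (hf : ∀ y ∈ f.support, y ∈ W) (r : MvPolynomial σ K) :
    coeff x (r * f) = constantCoeff r * coeff x f := by
  classical
  rw [coeff_mul, Finset.sum_eq_single (0, x)]
  · rfl
  · rintro ⟨p, q⟩ hpq hne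
    rw [HasAntidiagonal.mem_antidiagonal] at hpq
    dsimp only at hpq ⊢
    by_cases hq : q ∈ f.support
    · have hqx : q ≤ x := hpq ▸ le_add_self
      have hxq : q = x := le_antisymm hqx (hx.2 (hf q hq) hqx)
      subst hxq
      refine absurd ?_ hne
      rw [Prod.mk.injEq]
      exact ⟨by simpa using hpq, rfl⟩
    · rw [notMem_support_iff.1 hq, mul_zero]
  · intro h
    simp at h

/-- The coefficients of the minimal monomials of a monomial ideal, as a semilinear map. -/
noncomputable def minimalCoeffs (K : Type*) [Field K] (hW : IsUpperSet W) (G : Set (σ →₀ ℕ))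
    (hG : ∀ x ∈ G, Minimal (· ∈ W) x) :
    restrictSupportIdeal (R := K) W hW →ₛₗ[(constantCoeff : MvPolynomial σ K →+* K)] (G → K) where
  toFun f x := coeff x.1 f.1
  map_add' f g := by
    funext x
    exact coeff_add _ _ _
  map_smul' r f := by
    funext x
    exact coeff_mul_of_minimal (hG x.1 x.2) f.2 r

/-- The minimal number of generators of a quotient of monomial ideals `J ⧸ L` is the number of
minimal monomials of `J` that do not belong to `L`. -/
theorem spanFinrank_restrictSupportIdeal_quotient [Finite σ] {G : Set (σ →₀ ℕ)}
    (hG : G.Finite) (hGmin : ∀ x, x ∈ G ↔ Minimal (· ∈ W) x ∧ x ∉ V) :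
    (⊤ : Submodule (MvPolynomial σ K) (restrictSupportIdeal (R := K) W hW ⧸
      (restrictSupportIdeal (R := K) V hV).submoduleOf
        (restrictSupportIdeal (R := K) W hW))).spanFinrank = G.ncard := by
  classical
  set J := restrictSupportIdeal (R := K) W hW with hJ
  set L := restrictSupportIdeal (R := K) V hV with hL
  have hfin : Finite G := hG
  have := Fintype.ofFinite G
  have hmemJ : ∀ x ∈ W, ∀ c : K, monomial x c ∈ J := by
    intro x hx c
    rw [hJ, mem_restrictSupportIdeal_iff]
    intro y hy
    rw [Finset.mem_singleton.1 (support_monomial_subset hy)]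
    exact hx
  have hGW : ∀ x ∈ G, x ∈ W := fun x hx => ((hGmin x).1 hx).1.1
  apply le_antisymm
  · let φ : G → J ⧸ L.submoduleOf J := fun x =>
      (L.submoduleOf J).mkQ ⟨monomial x.1 1, hmemJ x.1 (hGW x.1 x.2) 1⟩
    have htop : Submodule.span (MvPolynomial σ K) (Set.range φ) = ⊤ := by
      rw [eq_top_iff]
      set N := Submodule.span (MvPolynomial σ K) (Set.range φ)
      -- The span is pulled back to an ideal of polynomials so that membership can be checked term
      -- by term.
      let Q : Ideal (MvPolynomial σ K) := (N.comap (L.submoduleOf J).mkQ).map J.subtype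
      have hJQ : J ≤ Q := by
        intro f hf
        rw [← support_sum_monomial_coeff f]
        refine Q.sum_mem fun x hx => ?_
        have hxW : x ∈ W := hf hx
        obtain ⟨y, hyx, hy⟩ := exists_minimal_le_of_wellFoundedLT (· ∈ W) x hxW
        by_cases hyV : y ∈ V
        · refine ⟨⟨monomial x (coeff x f), hmemJ x hxW _⟩, ?_, rfl⟩
          rw [SetLike.mem_coe, Submodule.mem_comap]
          convert N.zero_mem
          rw [Submodule.mkQ_apply, Submodule.Quotient.mk_eq_zero, Submodule.submoduleOf, Submodule.mem_comap, hL]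
          intro z hz
          rw [Finset.mem_singleton.1 (support_monomial_subset hz)]
          exact hV hyx hyV
        · have h1 : monomial x (coeff x f) = monomial (x - y) (coeff x f) * monomial y 1 := by
            rw [monomial_mul, mul_one, tsub_add_cancel_of_le hyx]
          rw [h1]
          refine Q.mul_mem_left _ ⟨⟨monomial y 1, hmemJ y hy.1 1⟩, ?_, rfl⟩
          exact Submodule.subset_span ⟨⟨y, (hGmin y).2 ⟨hy, hyV⟩⟩, rfl⟩
      rintro q -
      obtain ⟨⟨f, hf⟩, rfl⟩ := (L.submoduleOf J).mkQ_surjective q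
      obtain ⟨⟨f', hf'⟩, h1, h2⟩ := hJQ hf
      have h3 : f' = f := h2
      subst h3
      exact h1
    rw [← htop]
    refine (Submodule.spanFinrank_span_le_ncard_of_finite (Set.finite_range φ)).trans ?_
    rw [← Set.image_univ, ← Nat.card_coe_set_eq G, ← Set.ncard_univ]
    exact Set.ncard_image_le Set.finite_univ
  -- Lower bound: the coefficients at `G` map the quotient onto `G → K`, semilinearly along
  -- `constantCoeff`, so generators go to a spanning set of that vector space.
  · have : RingHomSurjective (constantCoeff : MvPolynomial σ K →+* K) :=
      ⟨fun c => ⟨C c, constantCoeff_C _ c⟩⟩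
    let ψ := minimalCoeffs K hW G fun x hx => ((hGmin x).1 hx).1
    have hker : L.submoduleOf J ≤ LinearMap.ker ψ := by
      rintro ⟨f, hf⟩ hfL
      rw [Submodule.submoduleOf, Submodule.mem_comap] at hfL
      rw [LinearMap.mem_ker]
      funext x
      change coeff x.1 f = 0
      by_contra hne
      exact ((hGmin x.1).1 x.2).2 (hfL (mem_support_iff.2 hne))
    have hsurj : Function.Surjective ((L.submoduleOf J).liftQ ψ hker) := by
      intro v
      refine ⟨(L.submoduleOf J).mkQ ⟨∑ x : G, monomial x.1 (v x),
        J.sum_mem fun x _ => hmemJ x.1 (hGW x.1 x.2) _⟩, ?_⟩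
      funext x
      change coeff x.1 (∑ y : G, monomial y.1 (v y)) = v x
      rw [coeff_sum, Finset.sum_eq_single x]
      · simp
      · intro y _ hyx
        rw [coeff_monomial, if_neg fun h => hyx (Subtype.ext h)]
      · simp
    have h1 := Submodule.spanFinrank_map_le_of_fg ((L.submoduleOf J).liftQ ψ hker)
      (p := ⊤) (IsNoetherian.noetherian _)
    rw [Submodule.map_top, LinearMap.range_eq_top.2 hsurj,
      ← Module.finrank_eq_spanFinrank_of_free, Module.finrank_fintype_fun_eq_card,
      ← Nat.card_eq_fintype_card, Nat.card_coe_set_eq] at h1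
    exact h1

end MinimalGenerators

/-! ### Counting rearrangements of a tuple. -/

section Rearrangements

open Finset

variable {s : ℕ}

/-- The stabilizer is the product of the symmetric groups of the level sets; values not attained
contribute `0! = 1`. -/
theorem typeFactorial_eq_card_stabilizer (lam : Fin s → ℕ) :
    typeFactorial lam = Fintype.card {g : Equiv.Perm (Fin s) // lam ∘ g = lam} := by
  rw [DomMulAct.stabilizer_card', typeFactorial]
  symm
  simp only [Fintype.card_subtype]
  refine prod_subset (fun i hi => ?_) fun i _ hi => ?_
  · obtain ⟨k, -, rfl⟩ := mem_image.1 hi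
    exact mem_range.2 (Nat.lt_succ_of_le (single_le_sum (fun _ _ => Nat.zero_le _) (mem_univ k)))
  · rw [card_eq_zero.2, Nat.factorial_zero]
    refine filter_eq_empty_iff.2 fun k _ hk => hi (mem_image.2 ⟨k, mem_univ k, hk⟩)

/-- The number of rearrangements of a tuple, multiplied with its type factorial. -/
theorem card_image_comp_perm_mul_typeFactorial (lam : Fin s → ℕ) :
    #(univ.image fun g : Equiv.Perm (Fin s) => lam ∘ g) * typeFactorial lam = s.factorial := by
  have h := card_eq_sum_card_image (fun g : Equiv.Perm (Fin s) => lam ∘ g) univ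
  rw [card_univ, Fintype.card_perm, Fintype.card_fin] at h
  rw [h, typeFactorial_eq_card_stabilizer, ← smul_eq_mul]
  refine (sum_const_nat fun f hf => ?_).symm
  obtain ⟨t, -, rfl⟩ := mem_image.1 hf
  rw [Fintype.card_subtype]
  -- The fibre over `lam ∘ t` is a coset of the stabilizer of `lam`.
  refine card_nbij' (fun g => g * t⁻¹) (fun g => g * t) ?_ ?_ ?_ ?_
  · intro g hg
    have hg' : lam ∘ g = lam ∘ t := by simpa using hg
    simp only [coe_filter, mem_univ, true_and, Set.mem_ofPred_eq]
    funext i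
    simpa using congrFun hg' (t⁻¹ i)
  · intro g hg
    have hg' : lam ∘ g = lam := by simpa using hg
    simp only [coe_filter, mem_univ, true_and, Set.mem_ofPred_eq]
    funext i
    simpa using congrFun hg' (t i)
  · intro g _
    simp
  · intro g _
    simp

theorem mem_image_comp_perm_iff {lam f : Fin s → ℕ} (hlam : Monotone lam) :
    f ∈ univ.image (fun g : Equiv.Perm (Fin s) => lam ∘ g) ↔ f ∘ Tuple.sort f = lam := by
  constructor
  · intro hf
    obtain ⟨g, -, rfl⟩ := mem_image.1 hf
    rw [Tuple.comp_perm_comp_sort_eq_comp_sort, Tuple.sort_eq_refl_iff_monotone.2 hlam]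
    rfl
  · intro h
    refine mem_image.2 ⟨(Tuple.sort f)⁻¹, mem_univ _, ?_⟩
    rw [← h]
    funext i
    simp

/-- The number of tuples whose sorted rearrangement belongs to a finite set of monotone tuples. -/
theorem ncard_comp_sort_mem {A : Set (Fin s → ℕ)} (hA : A.Finite) (hmono : ∀ f ∈ A, Monotone f) :
    {f : Fin s → ℕ | f ∘ Tuple.sort f ∈ A}.Finite ∧
    (({f : Fin s → ℕ | f ∘ Tuple.sort f ∈ A}.ncard : ℕ) : ℚ) =
      ∑ lam ∈ hA.toFinset, (s.factorial : ℚ) / (typeFactorial lam : ℚ) := by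
  have heq : {f : Fin s → ℕ | f ∘ Tuple.sort f ∈ A} =
      hA.toFinset.biUnion fun lam => univ.image fun g : Equiv.Perm (Fin s) => lam ∘ g := by
    ext f
    simp only [Set.mem_ofPred_eq, mem_coe, mem_biUnion, Set.Finite.mem_toFinset]
    constructor
    · exact fun h => ⟨_, h, (mem_image_comp_perm_iff (hmono _ h)).2 rfl⟩
    · rintro ⟨lam, hlam, hf⟩
      rwa [(mem_image_comp_perm_iff (hmono _ hlam)).1 hf]
  rw [heq]
  refine ⟨finite_toSet _, ?_⟩
  rw [Set.ncard_coe_finset, card_biUnion, Nat.cast_sum]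
  · refine sum_congr rfl fun lam _ => ?_
    have h := card_image_comp_perm_mul_typeFactorial lam
    have hne : typeFactorial lam ≠ 0 := by
      intro h0
      rw [h0, mul_zero] at h
      exact (Nat.factorial_pos s).ne h
    rw [eq_div_iff (by exact_mod_cast hne)]
    exact_mod_cast h
  · intro l₁ h₁ l₂ h₂ hne
    rw [Function.onFun, Finset.disjoint_left]
    intro f hf₁ hf₂
    rw [mem_coe, Set.Finite.mem_toFinset] at h₁ h₂
    rw [mem_image_comp_perm_iff (hmono _ h₁)] at hf₁
    rw [mem_image_comp_perm_iff (hmono _ h₂)] at hf₂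
    exact hne (hf₁.symm.trans hf₂)

end Rearrangements

/-! ### Minimal tuples and their sorted representatives. -/

section MinimalTuples

open Finset

variable {s k c C n : ℕ}

/-- The tuples all of whose `k`-element truncated partial sums are at least `C`. -/
def symbolicTuples (s k c C : ℕ) : Set (Fin s → ℕ) :=
  {f | ∀ S : Finset (Fin s), #S = k → C ≤ ∑ i ∈ S, min (f i) c}

/-- The minimal elements of `symbolicTuples` whose truncated sum is less than `n`. -/
def minimalTuples (s k c C n : ℕ) : Set (Fin s → ℕ) :=
  {f | Minimal (· ∈ symbolicTuples s k c C) f ∧ ∑ i, min (f i) c < n}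

theorem comp_perm_mem_symbolicTuples {f : Fin s → ℕ} (hf : f ∈ symbolicTuples s k c C)
    (g : Equiv.Perm (Fin s)) : f ∘ g ∈ symbolicTuples s k c C := by
  intro S hS
  have := hf (S.map g.toEmbedding) (by rwa [card_map])
  rwa [sum_map] at this

theorem comp_perm_mem_minimalTuples {f : Fin s → ℕ} (hf : f ∈ minimalTuples s k c C n)
    (g : Equiv.Perm (Fin s)) : f ∘ g ∈ minimalTuples s k c C n := by
  refine ⟨⟨comp_perm_mem_symbolicTuples hf.1.1 g, fun h hh hle i => ?_⟩, ?_⟩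
  · have := hf.1.2 (comp_perm_mem_symbolicTuples hh g⁻¹) (fun j => by simpa using hle (g⁻¹ j)) (g i)
    simpa using this
  · refine lt_of_eq_of_lt ?_ hf.2
    exact Equiv.sum_comp g fun i => min (f i) c

theorem comp_perm_mem_minimalTuples_iff {f : Fin s → ℕ} (g : Equiv.Perm (Fin s)) :
    f ∘ g ∈ minimalTuples s k c C n ↔ f ∈ minimalTuples s k c C n := by
  refine ⟨fun h => ?_, fun h => comp_perm_mem_minimalTuples h g⟩
  have := comp_perm_mem_minimalTuples h g⁻¹
  convert this using 1
  funext i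
  simp

/-- The first `k` indices. -/
def initialIndices (s k : ℕ) : Finset (Fin s) := univ.filter fun j => (j : ℕ) + 1 ≤ k

theorem mem_initialIndices {i : Fin s} : i ∈ initialIndices s k ↔ (i : ℕ) + 1 ≤ k := by
  simp [initialIndices]

theorem card_initialIndices (hk : k ≤ s) : #(initialIndices s k) = k := by
  have := Fin.card_filter_val_lt (n := s) (m := k)
  rwa [min_eq_right hk] at this

/-- The smallest `k`-element partial sum of a monotone tuple is the initial one. -/
theorem sum_initialIndices_le {f : Fin s → ℕ} (hf : Monotone f) (hks : k ≤ s) {S : Finset (Fin s)}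
    (hS : #S = k) : ∑ i ∈ initialIndices s k, f i ≤ ∑ i ∈ S, f i := by
  classical
  rcases Nat.eq_zero_or_pos k with rfl | hk
  · rw [card_eq_zero.1 (card_initialIndices (s := s) hks)]
    simp
  let l : Fin s := ⟨k - 1, by omega⟩
  rw [← sum_sdiff_le_sum_sdiff]
  have hcard : #(initialIndices s k \ S) = #(S \ initialIndices s k) :=
    card_sdiff_comm ((card_initialIndices hks).trans hS.symm)
  calc ∑ i ∈ initialIndices s k \ S, f i ≤ #(initialIndices s k \ S) • f l :=
        sum_le_card_nsmul _ _ _ fun i hi => hf (by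
          have := mem_initialIndices.1 (mem_sdiff.1 hi).1
          rw [Fin.le_def]; dsimp only [l]; omega)
    _ = #(S \ initialIndices s k) • f l := by rw [hcard]
    _ ≤ ∑ i ∈ S \ initialIndices s k, f i :=
        card_nsmul_le_sum _ _ _ fun i hi => hf (by
          have := mt mem_initialIndices.2 (mem_sdiff.1 hi).2
          rw [Fin.le_def]; dsimp only [l]; omega)

theorem mem_symbolicTuples_iff_of_monotone {f : Fin s → ℕ} (hf : Monotone f) (hks : k ≤ s) :
    f ∈ symbolicTuples s k c C ↔ C ≤ ∑ i ∈ initialIndices s k, min (f i) c :=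
  ⟨fun h => h _ (card_initialIndices hks), fun h _ hS => h.trans
    (sum_initialIndices_le (f := fun i => min (f i) c)
      (fun _ _ hij => min_le_min_right c (hf hij)) hks hS)⟩

theorem sum_eq_sum_initialIndices_add {f : Fin s → ℕ} (hks : k ≤ s) {t : ℕ}
    (ht : ∀ i : Fin s, k ≤ (i : ℕ) + 1 → f i = t) :
    ∑ i, f i = ∑ i ∈ initialIndices s k, f i + t * (s - k) := by
  classical
  rw [← sum_add_sum_compl (initialIndices s k)]
  congr 1
  rw [sum_const_nat (m := t), card_compl, card_initialIndices hks, Fintype.card_fin, mul_comm]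
  intro i hi
  have := mt mem_initialIndices.2 (mem_compl.1 hi)
  exact ht i (by omega)

/-- The monotone minimal tuples. -/
theorem mem_minimalTuples_iff_of_monotone {f : Fin s → ℕ} (hf : Monotone f) (hk : 1 ≤ k)
    (hks : k < s) (hC : 0 < C) (hn : C + c * (s - k) = n) :
    f ∈ minimalTuples s k c C n ↔ ∑ i ∈ initialIndices s k, f i = C ∧
      (∀ i j : Fin s, k ≤ (i : ℕ) + 1 → k ≤ (j : ℕ) + 1 → f i = f j) ∧
      ∀ i : Fin s, k ≤ (i : ℕ) + 1 → f i < c := by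
  classical
  let l : Fin s := ⟨k - 1, by omega⟩
  have hl : (l : ℕ) + 1 = k := by dsimp only [l]; omega
  constructor
  · rintro ⟨⟨hmem, hmin⟩, hlt⟩
    have hsum := (mem_symbolicTuples_iff_of_monotone hf hks.le).1 hmem
    -- Cutting all entries down to `min (f l) c` leaves the truncated sum of the first `k`
    -- unchanged, so minimality forbids larger entries.
    have hle : ∀ i, f i ≤ min (f l) c := by
      have hle' := hmin (y := fun i => min (f i) (min (f l) c)) ?_ fun i => min_le_left _ _
      · exact fun i => (hle' i).trans (min_le_right _ _)
      · change (fun i => min (f i) (min (f l) c)) ∈ symbolicTuples s k c C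
        rw [mem_symbolicTuples_iff_of_monotone
          (fun _ _ hij => min_le_min_right _ (hf hij)) hks.le]
        refine hsum.trans (sum_le_sum fun i hi => ?_)
        have : f i ≤ f l := hf (by
          have := mem_initialIndices.1 hi
          rw [Fin.le_def]; omega)
        omega
    have hc : ∀ i, min (f i) c = f i := fun i => by have := hle i; omega
    simp only [hc] at hsum hlt
    have heq : ∀ i : Fin s, k ≤ (i : ℕ) + 1 → f i = f l := by
      intro i hi
      refine le_antisymm ((hle i).trans (min_le_left _ _)) (hf ?_)
      rw [Fin.le_def]; omega
    have hC' : ∑ i ∈ initialIndices s k, f i = C := by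
      by_contra hne
      obtain ⟨i, -, hi⟩ : ∃ i ∈ initialIndices s k, f i ≠ 0 := by
        by_contra! h0
        rw [sum_eq_zero h0] at hsum
        omega
      -- If the least `k`-sum exceeded `C`, a nonzero entry could be lowered by one, as every
      -- `k`-sum drops by at most one.
      have h1 : f i ≤ f i - 1 := by
        have := hmin (y := fun j => f j - if i = j then 1 else 0) ?_ (fun j => Nat.sub_le _ _) i
        · simpa using this
        · intro S hS
          have h2 := sum_initialIndices_le hf hks.le hS
          have h3 : ∑ j ∈ S, f j ≤
              ∑ j ∈ S, (min (f j - if i = j then 1 else 0) c + if i = j then 1 else 0) := by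
            refine sum_le_sum fun j _ => ?_
            have := hc j
            split_ifs <;> omega
          have h4 : (∑ j ∈ S, if i = j then 1 else 0) ≤ 1 := by
            rw [sum_ite_eq]; split_ifs <;> omega
          rw [sum_add_distrib] at h3
          dsimp only
          omega
      omega
    refine ⟨hC', fun i j hi hj => (heq i hi).trans (heq j hj).symm, fun i hi => ?_⟩
    rw [heq i hi]
    by_contra! hcl
    rw [sum_eq_sum_initialIndices_add hks.le heq, hC', ← hn] at hlt
    have := Nat.mul_le_mul_right (s - k) hcl
    omega
  · rintro ⟨hsum, heq, hlt⟩
    have hfl : ∀ i, f i ≤ f l := by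
      intro i
      rcases le_total i l with h | h
      · exact hf h
      · rw [Fin.le_def] at h
        exact (heq i l (by omega) hl.ge).le
    have hfc : ∀ i, f i < c := fun i => (hfl i).trans_lt (hlt l hl.ge)
    have hc : ∀ i, min (f i) c = f i := fun i => min_eq_left (hfc i).le
    refine ⟨⟨?_, ?_⟩, ?_⟩
    · change f ∈ symbolicTuples s k c C
      rw [mem_symbolicTuples_iff_of_monotone hf hks.le]
      simp only [hc, hsum, le_refl]
    · intro g hg hgf i
      by_contra! hlt
      -- Every index lies in a `k`-set with sum exactly `C`: an index past the first `k` replaces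
      -- `l`, where `f` has the same value. So no entry can be lowered.
      obtain ⟨S, hS, hiS, hSsum⟩ : ∃ S : Finset (Fin s), #S = k ∧ i ∈ S ∧ ∑ j ∈ S, f j = C := by
        by_cases hi : i ∈ initialIndices s k
        · exact ⟨_, card_initialIndices hks.le, hi, hsum⟩
        · have hlS : l ∈ initialIndices s k := mem_initialIndices.2 hl.le
          have hi' : i ∉ (initialIndices s k).erase l := fun h => hi (mem_of_mem_erase h)
          refine ⟨insert i ((initialIndices s k).erase l), ?_, mem_insert_self _ _, ?_⟩
          · rw [card_insert_of_notMem hi', card_erase_of_mem hlS, card_initialIndices hks.le]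
            omega
          · rw [sum_insert hi', heq i l (by have := mt mem_initialIndices.2 hi; omega) hl.ge,
              add_sum_erase _ _ hlS, hsum]
      have h1 := hg S hS
      have h2 : ∑ j ∈ S, min (g j) c < ∑ j ∈ S, f j :=
        sum_lt_sum (fun j _ => (min_le_left _ _).trans (hgf j))
          ⟨i, hiS, (min_le_left _ _).trans_lt hlt⟩
      omega
    · simp only [hc]
      rw [sum_eq_sum_initialIndices_add hks.le (fun i hi => heq i l hi hl.ge), hsum, ← hn]
      exact Nat.add_lt_add_left (Nat.mul_lt_mul_of_pos_right (hfc l) (by omega)) _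

end MinimalTuples

/-! ### From minimal tuples to the symbolic defect. -/

section Defect

variable {s a b k m : ℕ}

theorem defectPartitions_finite (s a b m : ℕ) (hs : deltaParam s a b < s) :
    (defectPartitions s a b m).Finite := by
  refine (Set.finite_Iic (fun _ : Fin s => m * b)).subset fun f hf i => ?_
  have h := hf.2.2.2 ⟨s - 1, by omega⟩ (by dsimp only; omega)
  exact (hf.1 (Fin.le_def.2 (by dsimp only; omega))).trans h.le

theorem comp_sort_mem_defectPartitions_iff {C : ℕ} (hk : 1 ≤ k) (hks : k < s) (hC : 0 < C)
    (hn : C + m * b * (s - k) = m * a) (hdelta : s - deltaParam s a b = k)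
    (hCeq : m * (mu0Param s a b + b * (k - c0Param s a b)) = C) {f : Fin s → ℕ} :
    f ∘ Tuple.sort f ∈ defectPartitions s a b m ↔ f ∈ minimalTuples s k (m * b) C (m * a) := by
  rw [← comp_perm_mem_minimalTuples_iff (Tuple.sort f),
    mem_minimalTuples_iff_of_monotone (Tuple.monotone_sort f) hk hks hC hn]
  simp only [defectPartitions, Set.mem_ofPred_eq, hdelta, hCeq, truncatedSize]
  exact ⟨fun h => h.2, fun h => ⟨Tuple.monotone_sort f, h⟩⟩

theorem minimal_symbolicExponents_iff {c C n : ℕ} {x : Fin s →₀ ℕ} :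
    (Minimal (· ∈ symbolicExponents (Fin s) k c C) x ∧ x ∉ powerExponents (Fin s) c n) ↔
      ⇑x ∈ minimalTuples s k c C n := by
  refine and_congr (and_congr Iff.rfl ⟨?_, ?_⟩) (not_le (a := n))
  · exact fun h g hg hgx => h (y := Finsupp.equivFunOnFinite.symm g) hg hgx
  · exact fun h y hy hyx => h (y := y) hy hyx

theorem symbolicDefect_uniformMonomialIdeal (K : Type*) [Field K] {C : ℕ} (hb : 1 ≤ b)
    (hm : 1 ≤ m) (hks : k ≤ s) (hak : a + k = b * s + 1) (hC : C + m * b * (s - k) = m * a)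
    (hfin : (minimalTuples s k (m * b) C (m * a)).Finite) :
    symbolicDefect (uniformMonomialIdeal K s a b) m =
      (minimalTuples s k (m * b) C (m * a)).ncard := by
  rw [symbolicDefect, uniformMonomialIdeal_pow K s a b hm,
    symbolicPower_uniformMonomialIdeal K hb hm hks hak hC]
  rw [spanFinrank_restrictSupportIdeal_quotient
    (G := Finsupp.equivFunOnFinite ⁻¹' minimalTuples s k (m * b) C (m * a))
    (hfin.preimage (Finsupp.equivFunOnFinite.injective.injOn))
    fun x => minimal_symbolicExponents_iff.symm]
  exact Set.ncard_preimage_of_injective_subset_range Finsupp.equivFunOnFinite.injective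
    (by simp)

end Defect

theorem mainTheorem7 (K : Type*) [Field K] (s a b m : ℕ) (hb : 1 ≤ b) (hm : 1 ≤ m)
    (ha : (b - 1) * s + 1 < a) (ha' : a ≤ b * s) :
    ∃ hfin : (defectPartitions s a b m).Finite,
      (symbolicDefect (uniformMonomialIdeal K s a b) m : ℚ) =
        ∑ lam ∈ hfin.toFinset, (s.factorial : ℚ) / (typeFactorial lam : ℚ) := by
  obtain ⟨h1, -, h3, h4, h5⟩ := param_identities s a b hb ha ha'
  obtain ⟨d, hd⟩ : ∃ d, deltaParam s a b = d := ⟨_, rfl⟩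
  obtain ⟨e, he⟩ : ∃ e, c0Param s a b = e := ⟨_, rfl⟩
  obtain ⟨u, hu⟩ : ∃ u, mu0Param s a b = u := ⟨_, rfl⟩
  have hds : deltaParam s a b < s := by omega
  -- The strict bound on `a` gives δ ≥ 1, hence k < s.
  have hd1 : 1 ≤ d := by omega
  refine ⟨defectPartitions_finite s a b m hds, ?_⟩
  rw [hd] at h1 h5 hds
  rw [he] at h3 h4 h5
  rw [hu] at h3
  -- Writing s = c₀ + l + δ and shifting `b` by one removes the natural subtractions.
  obtain ⟨k, rfl⟩ : ∃ k, s = k + d := ⟨s - d, by omega⟩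
  obtain ⟨b, rfl⟩ : ∃ b', b = b' + 1 := ⟨b - 1, by omega⟩
  obtain ⟨l, rfl⟩ : ∃ l, k = e + l := ⟨k - e, by omega⟩
  have h6 : e + l + d - e = l + d := by omega
  rw [h6] at h3
  rw [Nat.add_sub_cancel] at h1
  have hak : a + (e + l) = (b + 1) * (e + l + d) + 1 := by
    rw [← h1]; ring
  have hCa : u + (b + 1) * l + (b + 1) * d = a := by rw [← h3]; ring
  have hCpos : 0 < m * (u + (b + 1) * l) := by
    refine Nat.mul_pos hm ?_
    by_contra h0
    have h0' : u + (b + 1) * l = 0 := by omega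
    rw [h0', zero_add] at hCa
    rw [← hCa] at hak
    nlinarith [Nat.zero_le (b * (e + l))]
  have hC : m * (u + (b + 1) * l) + m * (b + 1) * (e + l + d - (e + l)) = m * a := by
    rw [Nat.add_sub_cancel_left, ← hCa]; ring
  have hset : {f : Fin (e + l + d) → ℕ | f ∘ Tuple.sort f ∈
      defectPartitions (e + l + d) a (b + 1) m} =
      minimalTuples (e + l + d) (e + l) (m * (b + 1)) (m * (u + (b + 1) * l)) (m * a) := by
    ext f
    refine comp_sort_mem_defectPartitions_iff (by omega) (by omega) hCpos hC
      (by rw [hd, Nat.add_sub_cancel]) (by rw [he, hu, Nat.add_sub_cancel_left])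
  obtain ⟨h7, h8⟩ := ncard_comp_sort_mem (defectPartitions_finite (e + l + d) a (b + 1) m
    (by omega)) fun f hf => hf.1
  rw [← h8, hset, symbolicDefect_uniformMonomialIdeal K hb hm (by omega) hak hC (hset ▸ h7)]
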